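/- Let $\nu_1,\nu_2\ge 1$ be fixed integers and let $\lambda>1$ be a fixed real number. For every integer $M\ge 1$ consider a pool of coupons consisting of $M_1=\nu_1M$ coupons of Group 1, each having probability $p_1=p_1(M)>0$ to occur, and $M_2=\nu_2M$ coupons of Group 2, each having probability $p_2=p_2(M)>0$ to occur, where $M_1p_1+M_2p_2=1$ and $p_2/p_1=\lambda$. Coupons are drawn from the pool one at a time, independently and with replacement. For $j=1,2$ let $T_j=T_j(M)$ be the number of draws needed to detect every Group $j$ coupon at least once, and let $T=T(M)=T_1\vee T_2$ be the number of draws needed to detect all the coupons of the pool. Then, for every $M\ge 1$, $T$ is almost surely finite, and $$\frac{T-(\nu_1+\lambda\nu_2)\,M\ln M}{(\nu_1+\lambda\nu_2)\,M}-\ln\nu_1\;\xrightarrow{\;D\;}\;Y\qquad\text{as } M\to\infty,$$ where $\xrightarrow{\;D\;}$ denotes convergence in distribution and $Y$ is a standard Gumbel random variable, i.e. $P\{Y\le y\}=\exp(-e^{-y})$ for all $y\in\mathbb{R}$. -/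

import Mathlib

open MeasureTheory ProbabilityTheory Filter

/-- The pool of coupons: `M₁` coupons of Group 1 (left summand) and `M₂` coupons of Group 2
(right summand). -/
abbrev Coupon (M₁ M₂ : ℕ) : Type := Fin M₁ ⊕ Fin M₂

/-- `C 0, C 1, C 2, …` are the successive draws (with replacement) from a pool of `M₁` coupons of
Group 1, each having probability `p₁` to occur, and `M₂` coupons of Group 2, each having
probability `p₂` to occur: independent random variables with this common law. -/
structure IsCouponSampling {Ω : Type*} [MeasurableSpace Ω] (μ : Measure Ω) {M₁ M₂ : ℕ}
    (p₁ p₂ : ℝ) (C : ℕ → Ω → Coupon M₁ M₂) : Prop where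
  measurable : ∀ n, Measurable (C n)
  indep : iIndepFun C μ
  prob_group_one : ∀ n (i : Fin M₁), μ.real {ω | C n ω = Sum.inl i} = p₁
  prob_group_two : ∀ n (j : Fin M₂), μ.real {ω | C n ω = Sum.inr j} = p₂

/-- The number of draws of the sequence `c 0, c 1, …` needed to see every element of `G` at least
once, i.e. the least `n` such that each element of `G` is among the first `n` draws
`c 0, …, c (n - 1)`; it is `⊤` if this never happens. -/
noncomputable def collectionTime {α : Type*} (c : ℕ → α) (G : Set α) : ℕ∞ :=
  sInf {t : ℕ∞ | ∃ n : ℕ, t = n ∧ ∀ g ∈ G, ∃ k < n, c k = g}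

/-- `T₁`: the number of draws needed to detect all Group 1 coupons. -/
noncomputable def timeGroupOne {M₁ M₂ : ℕ} (c : ℕ → Coupon M₁ M₂) : ℕ∞ :=
  collectionTime c (Set.range Sum.inl)

/-- `T₂`: the number of draws needed to detect all Group 2 coupons. -/
noncomputable def timeGroupTwo {M₁ M₂ : ℕ} (c : ℕ → Coupon M₁ M₂) : ℕ∞ :=
  collectionTime c (Set.range Sum.inr)

/-- `T = T₁ ∨ T₂`: the number of draws needed to detect all coupons of both groups. -/
noncomputable def timeAll {M₁ M₂ : ℕ} (c : ℕ → Coupon M₁ M₂) : ℕ∞ :=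
  timeGroupOne c ⊔ timeGroupTwo c

/-- A standard Gumbel random variable: a real random variable `Y` with
`P {Y ≤ y} = exp (- exp (- y))` for all real `y`. -/
structure IsStandardGumbel {Ω : Type*} [MeasurableSpace Ω] (Y : Ω → ℝ) (P : Measure Ω) :
    Prop where
  measurable : Measurable Y
  cdf_eq : ∀ y : ℝ, P.real {ω | Y ω ≤ y} = Real.exp (-Real.exp (-y))

/-!
Since the coupons of Group 1 are the rare ones, the time `T` is governed by Group 1 alone. By
independence the first `n` draws avoid a set `S` of coupons with probability `(1 - p(S)) ^ n`, so
inclusion–exclusion gives the exact formula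
`P(T₁ ≤ n) = ∑ₖ (-1) ^ k * (M₁ choose k) * (1 - k * p₁) ^ n`
(`IsCouponSampling.measureReal_timeGroupOne_le`). If `n * p₁ - log M₁ → y`, the `k`-th term tends
to `(-exp (-y)) ^ k / k!` and is dominated by `exp (1 - y) ^ k / k!`, so Tannery's theorem yields
the limit `exp (-exp (-y))` (`tendsto_sum_choose_mul_one_sub_pow`).

For the same `n`, the expected number of missing Group 2 coupons is at most `M₂ * (1 - p₂) ^ n`,
which is of order `M₁ ^ (1 - lam)` and vanishes because `lam > 1`
(`tendsto_mul_one_sub_mul_pow_zero`); hence `T` has the same limit law as `T₁`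
(`IsCouponSampling.abs_measureReal_timeAll_le_sub_le`). As the probabilities sum to one,
`(ν₁ + lam * ν₂) * M = 1 / p₁`, so the normalization in the theorem is
`T * p₁ - log M₁`, and its distribution function at `y` is `P(T ≤ n)` with
`n = ⌊(log M₁ + y) / p₁⌋`. Convergence of distribution functions at every point then gives
convergence in distribution (`tendstoInDistribution_of_forall_tendsto_measureReal_le`).
-/

/-! ### Missing values among independent draws -/

section Draws

theorem compl_forall_mem_exists_lt_eq {Ω α : Type*} (C : ℕ → Ω → α) (n : ℕ) (G : Finset α) :
    {ω | ∀ g ∈ G, ∃ k < n, C k ω = g}ᶜ = ⋃ g ∈ G, {ω | ∀ k < n, C k ω ∉ ({g} : Finset α)} := by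
  ext ω; simp

variable {Ω α : Type*} [MeasurableSpace Ω] {μ : Measure Ω} [IsProbabilityMeasure μ]
  [MeasurableSpace α] [MeasurableSingletonClass α] {C : ℕ → Ω → α} {w : α → ℝ}

theorem measureReal_mem_finset (hC : ∀ n, Measurable (C n))
    (hw : ∀ n g, μ.real {ω | C n ω = g} = w g) (n : ℕ) (S : Finset α) :
    μ.real {ω | C n ω ∈ S} = ∑ g ∈ S, w g := by
  have h : {ω | C n ω ∈ S} = ⋃ g ∈ S, {ω | C n ω = g} := by
    ext ω; simp
  rw [h, measureReal_biUnion_finset]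
  · exact Finset.sum_congr rfl fun g _ => hw n g
  · intro a _ b _ hab
    refine Set.disjoint_left.2 fun ω h1 h2 => hab ?_
    exact (h1 : C n ω = a).symm.trans h2
  · exact fun g _ => hC n (measurableSet_singleton g)

/-- By independence, the first `n` draws all avoid `S` with probability `(1 - w(S)) ^ n`. -/
theorem measureReal_forall_lt_notMem (hC : ∀ n, Measurable (C n)) (hind : iIndepFun C μ)
    (hw : ∀ n g, μ.real {ω | C n ω = g} = w g) (n : ℕ) (S : Finset α) :
    μ.real {ω | ∀ k < n, C k ω ∉ S} = (1 - ∑ g ∈ S, w g) ^ n := by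
  have h : {ω | ∀ k < n, C k ω ∉ S} = ⋂ k ∈ Finset.range n, C k ⁻¹' (↑S : Set α)ᶜ := by
    ext ω; simp
  have hS : MeasurableSet (↑S : Set α) := S.measurableSet
  rw [h, measureReal_def, hind.measure_inter_preimage_eq_mul _ (fun _ _ => hS.compl),
    ENNReal.toReal_prod]
  have hk : ∀ k, (μ (C k ⁻¹' (↑S : Set α)ᶜ)).toReal = 1 - ∑ g ∈ S, w g := fun k => by
    rw [Set.preimage_compl, ← measureReal_def, probReal_compl_eq_one_sub (hC k hS),
      ← measureReal_mem_finset hC hw k S]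
    rfl
  rw [Finset.prod_congr rfl fun k _ => hk k]
  simp

theorem measurableSet_forall_mem_exists_lt_eq (hC : ∀ n, Measurable (C n)) (n : ℕ)
    (G : Finset α) : MeasurableSet {ω | ∀ g ∈ G, ∃ k < n, C k ω = g} := by
  have h : {ω | ∀ g ∈ G, ∃ k < n, C k ω = g}
      = ⋂ g ∈ G, ⋃ k ∈ Finset.range n, C k ⁻¹' {g} := by
    ext ω; simp
  rw [h]
  exact G.measurableSet_biInter fun g _ =>
    (Finset.range n).measurableSet_biUnion fun k _ => hC k (measurableSet_singleton g)

/-- The union bound for the event that some element of `G` is missing from the first `n` draws. -/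
theorem measureReal_compl_forall_mem_exists_lt_eq_le (hC : ∀ n, Measurable (C n))
    (hind : iIndepFun C μ) (hw : ∀ n g, μ.real {ω | C n ω = g} = w g) (n : ℕ) (G : Finset α) :
    μ.real {ω | ∀ g ∈ G, ∃ k < n, C k ω = g}ᶜ ≤ ∑ g ∈ G, (1 - w g) ^ n := by
  rw [compl_forall_mem_exists_lt_eq]
  refine (measureReal_biUnion_finset_le _ _).trans_eq (Finset.sum_congr rfl fun g _ => ?_)
  rw [measureReal_forall_lt_notMem hC hind hw, Finset.sum_singleton]

/-- Inclusion–exclusion over the set of elements of `G` that are missing from the first `n`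
draws, when all elements of `G` have the same probability `p`. -/
theorem measureReal_forall_mem_exists_lt_eq (hC : ∀ n, Measurable (C n))
    (hind : iIndepFun C μ) (hw : ∀ n g, μ.real {ω | C n ω = g} = w g) (n : ℕ) (G : Finset α)
    {p : ℝ} (hG : ∀ g ∈ G, w g = p) :
    μ.real {ω | ∀ g ∈ G, ∃ k < n, C k ω = g}
      = ∑ k ∈ Finset.range (G.card + 1), (-1) ^ k * (G.card.choose k : ℝ) * (1 - k * p) ^ n := by
  classical
  set A : α → Set Ω := fun g => {ω | ∀ k < n, C k ω ∉ ({g} : Finset α)} with hA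
  have hAm : ∀ g, MeasurableSet (A g) := fun g => by
    have h := (measurableSet_forall_mem_exists_lt_eq hC n {g}).compl
    rw [compl_forall_mem_exists_lt_eq] at h
    simpa [A] using h
  have hInter : ∀ S ⊆ G, μ.real (⋂ g ∈ S, A g) = (1 - S.card * p) ^ n := fun S hS => by
    have h : ⋂ g ∈ S, A g = {ω | ∀ k < n, C k ω ∉ S} := by
      ext ω
      simp only [A, Set.mem_iInter, Set.mem_ofPred_eq, Finset.mem_singleton]
      exact ⟨fun H k hk hm => H _ hm k hk rfl, fun H g hg k hk e => H k hk (e ▸ hg)⟩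
    rw [h, measureReal_forall_lt_notMem hC hind hw, Finset.sum_congr rfl fun g hg => hG g (hS hg)]
    simp
  have hcompl := probReal_compl_eq_one_sub (μ := μ)
    (measurableSet_forall_mem_exists_lt_eq hC n G).compl
  rw [compl_compl] at hcompl
  rw [hcompl, compl_forall_mem_exists_lt_eq,
    measureReal_biUnion_eq_sum_powerset (fun g _ => hAm g) (fun g _ => by finiteness)]
  have hsplit : ∑ S ∈ G.powerset, (-1 : ℝ) ^ S.card * (1 - S.card * p) ^ n
      = 1 - ∑ t ∈ G.powerset with t.Nonempty, (-1 : ℝ) ^ (t.card + 1) * μ.real (⋂ g ∈ t, A g) := by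
    rw [← Finset.sum_filter_add_sum_filter_not G.powerset (fun t => t.Nonempty)]
    have h0 : G.powerset.filter (fun t => ¬ t.Nonempty) = {∅} := by
      ext t
      simp only [Finset.mem_filter, Finset.mem_powerset, Finset.not_nonempty_iff_eq_empty,
        Finset.mem_singleton]
      exact ⟨fun h => h.2, fun h => ⟨h ▸ Finset.empty_subset _, h⟩⟩
    rw [h0, Finset.sum_singleton, add_comm]
    simp only [Finset.card_empty, pow_zero, Nat.cast_zero, zero_mul, sub_zero, one_pow, mul_one]
    rw [sub_eq_add_neg, ← Finset.sum_neg_distrib]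
    congr 1
    refine Finset.sum_congr rfl fun t ht => ?_
    rw [hInter t (Finset.mem_powerset.1 (Finset.mem_filter.1 ht).1)]
    ring
  rw [← hsplit,
    Finset.sum_powerset_apply_card (fun k => (-1 : ℝ) ^ k * (1 - k * p) ^ n) (x := G)]
  refine Finset.sum_congr rfl fun k _ => ?_
  rw [nsmul_eq_mul]; ring

end Draws

/-! ### Collection times and coupon sampling -/

section CollectionTime

theorem collectionTime_le_iff {α : Type*} (c : ℕ → α) (G : Set α) (n : ℕ) :
    collectionTime c G ≤ n ↔ ∀ g ∈ G, ∃ k < n, c k = g := by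
  refine ⟨fun h => ?_, fun h => sInf_le ⟨n, rfl, h⟩⟩
  have hlt : collectionTime c G < ((n + 1 : ℕ) : ℕ∞) :=
    h.trans_lt (by exact_mod_cast Nat.lt_succ_self n)
  obtain ⟨t, ⟨m, rfl, hm⟩, ht⟩ := sInf_lt_iff.1 hlt
  have hmn : m < n + 1 := by exact_mod_cast ht
  intro g hg
  obtain ⟨k, hk, e⟩ := hm g hg
  exact ⟨k, by omega, e⟩

variable {M₁ M₂ : ℕ}

theorem timeGroupOne_le_iff (c : ℕ → Coupon M₁ M₂) (n : ℕ) :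
    timeGroupOne c ≤ n ↔ ∀ g ∈ Finset.univ.map ⟨(Sum.inl : Fin M₁ → Coupon M₁ M₂),
      Sum.inl_injective⟩, ∃ k < n, c k = g := by
  simp [timeGroupOne, collectionTime_le_iff]

theorem timeGroupTwo_le_iff (c : ℕ → Coupon M₁ M₂) (n : ℕ) :
    timeGroupTwo c ≤ n ↔ ∀ g ∈ Finset.univ.map ⟨(Sum.inr : Fin M₂ → Coupon M₁ M₂),
      Sum.inr_injective⟩, ∃ k < n, c k = g := by
  simp [timeGroupTwo, collectionTime_le_iff]

theorem timeAll_le_iff (c : ℕ → Coupon M₁ M₂) (n : ℕ) :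
    timeAll c ≤ n ↔ ∀ g ∈ (Finset.univ : Finset (Coupon M₁ M₂)), ∃ k < n, c k = g := by
  simp [timeAll, timeGroupOne, timeGroupTwo, collectionTime_le_iff]

end CollectionTime

instance {M₁ M₂ : ℕ} : MeasurableSingletonClass (Coupon M₁ M₂) where
  measurableSet_singleton g := by
    cases g <;> simp [measurableSet_sum_iff]

namespace IsCouponSampling

variable {Ω : Type*} [MeasurableSpace Ω] {μ : Measure Ω} {M₁ M₂ : ℕ}
  {p₁ p₂ : ℝ} {C : ℕ → Ω → Coupon M₁ M₂}

theorem measureReal_eq (h : IsCouponSampling μ p₁ p₂ C) (n : ℕ) (g : Coupon M₁ M₂) :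
    μ.real {ω | C n ω = g} = Sum.elim (fun _ => p₁) (fun _ => p₂) g := by
  cases g with
  | inl i => exact h.prob_group_one n i
  | inr j => exact h.prob_group_two n j

theorem measurable_timeAll (h : IsCouponSampling μ p₁ p₂ C) :
    Measurable fun ω => timeAll fun n => C n ω := by
  -- All subsets of the countable space `ℕ∞` are measurable, also for its Borel σ-algebra.
  have : BorelSpace ℕ∞ := ⟨borel_eq_top_of_countable.symm⟩
  refine measurable_of_Iic fun t => ?_
  induction t using ENat.recTopCoe with
  | top => simp
  | coe n =>
    have := measurableSet_forall_mem_exists_lt_eq h.measurable n Finset.univ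
    simp_rw [← timeAll_le_iff] at this
    exact this

variable [IsProbabilityMeasure μ]

theorem total_eq_one (h : IsCouponSampling μ p₁ p₂ C) : M₁ * p₁ + M₂ * p₂ = 1 := by
  have := measureReal_mem_finset h.measurable h.measureReal_eq 0 Finset.univ
  simpa using this.symm

theorem ae_timeAll_ne_top (h : IsCouponSampling μ p₁ p₂ C) (hp₁ : 0 < p₁) (hp₂ : 0 < p₂) :
    ∀ᵐ ω ∂μ, timeAll (fun n => C n ω) ≠ ⊤ := by
  set w : Coupon M₁ M₂ → ℝ := Sum.elim (fun _ => p₁) (fun _ => p₂) with hw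
  have hw0 : ∀ g, 0 < w g := by rintro (i | j) <;> simpa [w]
  have hw1 : ∀ g, w g ≤ 1 := fun g => by
    exact (h.measureReal_eq 0 g).symm.trans_le measureReal_le_one
  have hlim : Tendsto (fun n : ℕ => ∑ g, (1 - w g) ^ n) atTop (nhds 0) := by
    rw [← Finset.sum_const_zero (s := (Finset.univ : Finset (Coupon M₁ M₂)))]
    exact tendsto_finsetSum _ fun g _ =>
      tendsto_pow_atTop_nhds_zero_of_lt_one (by linarith [hw1 g]) (by linarith [hw0 g])
  have hle : ∀ n : ℕ, μ.real {ω | timeAll (fun n => C n ω) = ⊤} ≤ ∑ g, (1 - w g) ^ n := fun n => by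
    refine le_trans (measureReal_mono ?_) (measureReal_compl_forall_mem_exists_lt_eq_le
      h.measurable h.indep h.measureReal_eq n Finset.univ)
    intro ω (hω : _ = _)
    simp only [Set.mem_compl_iff, Set.mem_ofPred_eq]
    rw [← timeAll_le_iff (fun n => C n ω), hω]
    simp
  have h0 : μ.real {ω | timeAll (fun n => C n ω) = ⊤} = 0 :=
    le_antisymm (ge_of_tendsto' hlim hle) measureReal_nonneg
  rw [ae_iff]
  simpa [measureReal_eq_zero_iff] using h0

/-- The law of `T₁` by inclusion–exclusion. -/
theorem measureReal_timeGroupOne_le (h : IsCouponSampling μ p₁ p₂ C) (n : ℕ) :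
    μ.real {ω | timeGroupOne (fun n => C n ω) ≤ n}
      = ∑ k ∈ Finset.range (M₁ + 1), (-1) ^ k * (M₁.choose k : ℝ) * (1 - k * p₁) ^ n := by
  simp_rw [timeGroupOne_le_iff]
  rw [measureReal_forall_mem_exists_lt_eq h.measurable h.indep h.measureReal_eq n _ (p := p₁)
    (by simp)]
  simp

theorem measureReal_compl_timeGroupTwo_le (h : IsCouponSampling μ p₁ p₂ C) (n : ℕ) :
    μ.real {ω | timeGroupTwo (fun n => C n ω) ≤ n}ᶜ ≤ M₂ * (1 - p₂) ^ n := by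
  simp_rw [timeGroupTwo_le_iff]
  refine (measureReal_compl_forall_mem_exists_lt_eq_le h.measurable h.indep h.measureReal_eq
    n _).trans_eq ?_
  simp

/-- The coupons of Group 2 perturb the law of `T₁` by at most the probability that one of them is
missing. -/
theorem abs_measureReal_timeAll_le_sub_le (h : IsCouponSampling μ p₁ p₂ C) (n : ℕ) :
    |μ.real {ω | timeAll (fun n => C n ω) ≤ n} - μ.real {ω | timeGroupOne (fun n => C n ω) ≤ n}|
      ≤ M₂ * (1 - p₂) ^ n := by
  have h1 : μ.real {ω | timeAll (fun n => C n ω) ≤ n}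
      ≤ μ.real {ω | timeGroupOne (fun n => C n ω) ≤ n} :=
    measureReal_mono fun ω hω => le_trans (le_sup_left : timeGroupOne (fun n => C n ω) ≤ _) hω
  have h2 : μ.real {ω | timeGroupOne (fun n => C n ω) ≤ n}
      ≤ μ.real {ω | timeAll (fun n => C n ω) ≤ n}
        + μ.real {ω | timeGroupTwo (fun n => C n ω) ≤ n}ᶜ := by
    refine le_trans (measureReal_mono ?_) (measureReal_union_le _ _)
    intro ω hω
    by_cases h2 : timeGroupTwo (fun n => C n ω) ≤ n
    · exact Or.inl (sup_le hω h2)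
    · exact Or.inr h2
  have := h.measureReal_compl_timeGroupTwo_le n
  rw [abs_le]
  constructor <;> linarith

end IsCouponSampling

/-! ### Asymptotics of the inclusion–exclusion sum -/

section Asymptotics

variable {ι : Type*} {l : Filter ι} {m n : ι → ℕ} {p : ι → ℝ} {y : ℝ}

theorem tendsto_zero_of_mul_le_one (hm : Tendsto m l atTop) (hp : ∀ i, 0 ≤ p i)
    (hmp : ∀ i, m i * p i ≤ 1) : Tendsto p l (nhds 0) := by
  have hinv : Tendsto (fun i => ((m i : ℝ))⁻¹) l (nhds 0) :=
    tendsto_inv_atTop_zero.comp (tendsto_natCast_atTop_atTop.comp hm)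
  refine squeeze_zero' (Eventually.of_forall hp) ?_ hinv
  filter_upwards [hm.eventually_ge_atTop 1] with i hi
  have : (0 : ℝ) < m i := by exact_mod_cast hi
  rw [inv_eq_one_div, le_div_iff₀ this, mul_comm]
  exact hmp i

theorem tendsto_mul_sq_zero (hm : Tendsto m l atTop) (hp : ∀ i, 0 ≤ p i)
    (hmp : ∀ i, m i * p i ≤ 1)
    (hnp : Tendsto (fun i => n i * p i - Real.log (m i)) l (nhds y)) :
    Tendsto (fun i => n i * p i ^ 2) l (nhds 0) := by
  have hp0 := tendsto_zero_of_mul_le_one hm hp hmp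
  have hmR : Tendsto (fun i => (m i : ℝ)) l atTop := tendsto_natCast_atTop_atTop.comp hm
  have hlog : Tendsto (fun i => Real.log (m i) / m i) l (nhds 0) :=
    (Real.isLittleO_log_id_atTop.tendsto_div_nhds_zero).comp hmR
  have hlogp : Tendsto (fun i => Real.log (m i) * p i) l (nhds 0) := by
    refine squeeze_zero (fun i => mul_nonneg (Real.log_natCast_nonneg _) (hp i)) (fun i => ?_) hlog
    rcases Nat.eq_zero_or_pos (m i) with h | h
    · simp [h]
    · have : (0 : ℝ) < m i := by exact_mod_cast h
      rw [le_div_iff₀ this, mul_assoc]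
      exact mul_le_of_le_one_right (Real.log_natCast_nonneg _) (by rw [mul_comm]; exact hmp i)
  have := (hnp.mul hp0).add hlogp
  simp only [mul_zero, add_zero] at this
  refine this.congr fun i => by ring

/-- Individual terms of the inclusion–exclusion sum: `m ^ k * (1 - k * p) ^ n` behaves like
`exp (-k * (n * p - log m))`. -/
theorem tendsto_pow_mul_one_sub_pow (hm : Tendsto m l atTop) (hp : ∀ i, 0 ≤ p i)
    (hmp : ∀ i, m i * p i ≤ 1)
    (hnp : Tendsto (fun i => n i * p i - Real.log (m i)) l (nhds y)) (k : ℕ) :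
    Tendsto (fun i => (m i : ℝ) ^ k * (1 - k * p i) ^ n i) l (nhds (Real.exp (-y) ^ k)) := by
  have hp0 := tendsto_zero_of_mul_le_one hm hp hmp
  have hsq := tendsto_mul_sq_zero hm hp hmp hnp
  have hkp : Tendsto (fun i => k * p i) l (nhds 0) := by simpa using hp0.const_mul (k : ℝ)
  have hsmall : ∀ᶠ i in l, k * p i < 1 / 2 := hkp.eventually_lt_const (by norm_num)
  have herr : Tendsto (fun i => n i * (Real.log (1 - k * p i) + k * p i)) l (nhds 0) := by
    have hlow : Tendsto (fun i => -(2 * k ^ 2 * (n i * p i ^ 2))) l (nhds 0) := by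
      simpa using (hsq.const_mul (2 * (k : ℝ) ^ 2)).neg
    refine tendsto_of_tendsto_of_tendsto_of_le_of_le' hlow tendsto_const_nhds ?_ ?_
    · filter_upwards [hsmall] with i hi
      have hx : 0 ≤ k * p i := mul_nonneg k.cast_nonneg (hp i)
      have h1 := Real.one_sub_inv_le_log_of_pos (x := 1 - k * p i) (by linarith)
      have h2 : -(2 * (k * p i) ^ 2) - k * p i ≤ 1 - (1 - k * p i)⁻¹ := by
        -- `1 - (1 - x)⁻¹ = -x - x ^ 2 / (1 - x)`, and `1 - x ≥ 1 / 2`.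
        set x := k * p i
        have : (1 - x)⁻¹ ≤ 1 + x + 2 * x ^ 2 := by
          rw [inv_le_iff_one_le_mul₀ (by linarith)]
          nlinarith [mul_nonneg (sq_nonneg x) (by linarith : 0 ≤ 1 - 2 * x)]
        linarith
      have h3 := mul_le_mul_of_nonneg_left
        (by linarith : -(2 * (k * p i) ^ 2) ≤ Real.log (1 - k * p i) + k * p i)
        (Nat.cast_nonneg (α := ℝ) (n i))
      linarith
    · filter_upwards [hsmall] with i hi
      have h1 := Real.log_le_sub_one_of_pos (x := 1 - k * p i) (by linarith)
      exact mul_nonpos_of_nonneg_of_nonpos (Nat.cast_nonneg _) (by linarith)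
  have hexp := (Real.continuous_exp.tendsto _).comp (herr.sub (hnp.const_mul (k : ℝ)))
  have hval : Real.exp (0 - k * y) = Real.exp (-y) ^ k := by
    rw [← Real.exp_nat_mul]; ring_nf
  rw [hval] at hexp
  refine hexp.congr' ?_
  filter_upwards [hsmall, hm.eventually_ge_atTop 1] with i hi hmi
  have hmpos : (0 : ℝ) < m i := by exact_mod_cast hmi
  have h1 : (m i : ℝ) ^ k = Real.exp (k * Real.log (m i)) := by
    rw [Real.exp_nat_mul, Real.exp_log hmpos]
  have h2 : (1 - k * p i) ^ n i = Real.exp (n i * Real.log (1 - k * p i)) := by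
    rw [Real.exp_nat_mul, Real.exp_log (by linarith)]
  rw [h1, h2, ← Real.exp_add]
  refine congrArg Real.exp ?_
  ring

/-- Tannery's theorem applied to the inclusion–exclusion sum, whose `k`-th term is dominated by
`c ^ k / k!` with `c = exp (1 - y)`. -/
theorem tendsto_sum_choose_mul_one_sub_pow (hm : Tendsto m l atTop) (hp : ∀ i, 0 ≤ p i)
    (hmp : ∀ i, m i * p i ≤ 1)
    (hnp : Tendsto (fun i => n i * p i - Real.log (m i)) l (nhds y)) :
    Tendsto (fun i => ∑ k ∈ Finset.range (m i + 1),
        (-1) ^ k * ((m i).choose k : ℝ) * (1 - k * p i) ^ n i)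
      l (nhds (Real.exp (-Real.exp (-y)))) := by
  set f : ι → ℕ → ℝ := fun i k => (-1) ^ k * ((m i).choose k : ℝ) * (1 - k * p i) ^ n i with hf
  have hsum : ∀ i, ∑ k ∈ Finset.range (m i + 1), f i k = ∑' k, f i k := fun i => by
    refine (tsum_eq_sum fun k hk => ?_).symm
    rw [Finset.mem_range, not_lt] at hk
    simp [f, Nat.choose_eq_zero_of_lt (show m i < k by omega)]
  have hexp : Real.exp (-Real.exp (-y)) = ∑' k : ℕ, (-Real.exp (-y)) ^ k / (k.factorial : ℝ) := by
    rw [Real.exp_eq_exp_ℝ, NormedSpace.exp_eq_tsum_div]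
  rw [hexp]
  refine Tendsto.congr (fun i => (hsum i).symm) ?_
  refine tendsto_tsum_of_dominated_convergence
    (bound := fun k => Real.exp (1 - y) ^ k / (k.factorial : ℝ))
    (Real.summable_pow_div_factorial _) (fun k => ?_) ?_
  · have hch : Tendsto (fun i => ((m i).choose k : ℝ) / ((m i : ℝ) ^ k / k.factorial)) l
        (nhds 1) := by
      have h0 : ∀ᶠ N : ℕ in atTop, ((N : ℝ) ^ k / k.factorial) ≠ 0 := by
        filter_upwards [eventually_ge_atTop 1] with N hN
        have : (0 : ℝ) < N := by exact_mod_cast hN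
        positivity
      exact ((Asymptotics.isEquivalent_iff_tendsto_one h0).1 (isEquivalent_choose k)).comp hm
    have h := ((hch.mul (tendsto_pow_mul_one_sub_pow hm hp hmp hnp k)).const_mul
      ((-1 : ℝ) ^ k / k.factorial))
    have hv : (-1 : ℝ) ^ k / k.factorial * (1 * Real.exp (-y) ^ k)
        = (-Real.exp (-y)) ^ k / k.factorial := by
      rw [neg_pow (Real.exp (-y))]; ring
    rw [hv] at h
    refine h.congr' ?_
    filter_upwards [hm.eventually_ge_atTop 1] with i hi
    have : (0 : ℝ) < m i := by exact_mod_cast hi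
    have : (k.factorial : ℝ) ≠ 0 := by positivity
    simp only [f]
    field_simp
  · filter_upwards [hnp.eventually_const_lt (show y - 1 < y by linarith),
      hm.eventually_ge_atTop 1] with i hi hmi k
    have hmpos : (0 : ℝ) < m i := by exact_mod_cast hmi
    rcases le_or_gt k (m i) with hk | hk
    · have hk' : (k : ℝ) ≤ m i := by exact_mod_cast hk
      have hx : 0 ≤ 1 - k * p i := by
        linarith [hmp i, mul_le_mul_of_nonneg_right hk' (hp i)]
      have h1 : (1 - k * p i) ^ n i ≤ Real.exp (-(k * (n i * p i))) := by
        calc (1 - k * p i) ^ n i ≤ Real.exp (-(k * p i)) ^ n i :=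
              pow_le_pow_left₀ hx (Real.one_sub_le_exp_neg _) _
          _ = _ := by rw [← Real.exp_nat_mul]; ring_nf
      have h2 : ((m i).choose k : ℝ) ≤ (m i : ℝ) ^ k / k.factorial := Nat.choose_le_pow_div k (m i)
      have h3 : (m i : ℝ) ^ k = Real.exp (k * Real.log (m i)) := by
        rw [Real.exp_nat_mul, Real.exp_log hmpos]
      have h4 : Real.exp (1 - y) ^ k = Real.exp (k * (1 - y)) := by rw [Real.exp_nat_mul]
      calc ‖f i k‖ = ((m i).choose k : ℝ) * (1 - k * p i) ^ n i := by
            simp [f, abs_of_nonneg hx]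
        _ ≤ (m i : ℝ) ^ k / k.factorial * Real.exp (-(k * (n i * p i))) := by gcongr
        _ = Real.exp (k * (Real.log (m i) - n i * p i)) / k.factorial := by
            rw [h3, div_mul_eq_mul_div, ← Real.exp_add]; ring_nf
        _ ≤ Real.exp (1 - y) ^ k / k.factorial := by
            have h5 : Real.log (m i) - n i * p i ≤ 1 - y := by linarith
            rw [h4]; gcongr
    -- For `k > m` the base `1 - k * p` may be negative, but the binomial coefficient vanishes.
    · have : f i k = 0 := by simp [f, Nat.choose_eq_zero_of_lt hk]
      rw [this, norm_zero]; positivity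

end Asymptotics

/-- With `n = ⌊x⌋` draws, `x = (log m + y) / p`, the mean number `n * p` of occurrences of a coupon
is `log m + y + O(p)`. -/
theorem tendsto_natFloor_mul_sub_log {ι : Type*} {l : Filter ι} {m : ι → ℕ} {p : ι → ℝ}
    (hm : Tendsto m l atTop) (hp : ∀ i, 0 < p i) (hmp : ∀ i, m i * p i ≤ 1) (y : ℝ) :
    Tendsto (fun i => (⌊(Real.log (m i) + y) / p i⌋₊ : ℝ) * p i - Real.log (m i)) l
      (nhds y) := by
  have hp0 := tendsto_zero_of_mul_le_one hm (fun i => (hp i).le) hmp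
  have hlog : Tendsto (fun i => Real.log (m i)) l atTop :=
    Real.tendsto_log_atTop.comp (tendsto_natCast_atTop_atTop.comp hm)
  have hlow : Tendsto (fun i => y - p i) l (nhds y) := by simpa using hp0.const_sub y
  refine tendsto_of_tendsto_of_tendsto_of_le_of_le' hlow tendsto_const_nhds ?_ ?_
  · refine Eventually.of_forall fun i => ?_
    have h1 := Nat.lt_floor_add_one ((Real.log (m i) + y) / p i)
    rw [div_lt_iff₀ (hp i)] at h1
    linarith
  · filter_upwards [hlog.eventually_ge_atTop (-y)] with i hi
    have h1 := Nat.floor_le (div_nonneg (by linarith : 0 ≤ Real.log (m i) + y) (hp i).le)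
    rw [le_div_iff₀ (hp i)] at h1
    linarith

/-- When `n * p = log m + O(1)`, the expected number of missing coupons in a group of size
proportional to `m`, whose coupons have probability `lam * p`, is of order `m ^ (1 - lam)`. -/
theorem tendsto_mul_one_sub_mul_pow_zero {ι : Type*} {l : Filter ι} {m m' n : ι → ℕ}
    {p q : ι → ℝ} {y lam a : ℝ} (hlam : 1 < lam) (hm : Tendsto m l atTop)
    (hm' : ∀ i, (m' i : ℝ) = a * m i) (hq : ∀ i, q i = lam * p i) (hq1 : ∀ i, q i ≤ 1)
    (hnp : Tendsto (fun i => n i * p i - Real.log (m i)) l (nhds y)) :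
    Tendsto (fun i => (m' i : ℝ) * (1 - q i) ^ n i) l (nhds 0) := by
  have hlog : Tendsto (fun i => Real.log (m i)) l atTop :=
    Real.tendsto_log_atTop.comp (tendsto_natCast_atTop_atTop.comp hm)
  have hexp : Tendsto (fun i => Real.exp (-((lam - 1) * Real.log (m i)
      + lam * (n i * p i - Real.log (m i))))) l (nhds 0) :=
    Real.tendsto_exp_neg_atTop_nhds_zero.comp
      ((hlog.const_mul_atTop (by linarith : 0 < lam - 1)).atTop_add (hnp.const_mul lam))
  refine squeeze_zero' (g := fun i => a * Real.exp (-((lam - 1) * Real.log (m i)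
      + lam * (n i * p i - Real.log (m i))))) ?_ ?_ (by simpa using hexp.const_mul a)
  · exact Eventually.of_forall fun i =>
      mul_nonneg (Nat.cast_nonneg _) (pow_nonneg (by linarith [hq1 i]) _)
  · filter_upwards [hm.eventually_ge_atTop 1] with i hi
    have hpos : (0 : ℝ) < m i := by exact_mod_cast hi
    calc (m' i : ℝ) * (1 - q i) ^ n i ≤ (m' i : ℝ) * Real.exp (-q i) ^ n i := by
          gcongr
          · linarith [hq1 i]
          · exact Real.one_sub_le_exp_neg _
      _ = a * (Real.exp (Real.log (m i)) * Real.exp (n i * -q i)) := by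
          rw [Real.exp_nat_mul, Real.exp_log hpos, hm']; ring
      _ = _ := by rw [← Real.exp_add, hq]; ring_nf

/-! ### Convergence of distribution functions -/

theorem measureReal_map_Ioc {Ω : Type*} [MeasurableSpace Ω] {μ : Measure Ω} [IsFiniteMeasure μ]
    {Z : Ω → ℝ} (hZ : Measurable Z) {a b : ℝ} (hab : a ≤ b) :
    (μ.map Z).real (Set.Ioc a b) = μ.real {ω | Z ω ≤ b} - μ.real {ω | Z ω ≤ a} := by
  have hsub : {ω | Z ω ≤ a} ⊆ {ω | Z ω ≤ b} := fun ω (hω : Z ω ≤ a) => hω.trans hab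
  rw [map_measureReal_apply hZ measurableSet_Ioc, ← measureReal_sdiff hsub (hZ measurableSet_Iic)]
  congr 1
  ext ω; simp [and_comm]

/-- Pointwise convergence of the distribution functions at every point implies convergence in
distribution: the intervals `Ioc a b` form a π-system containing small neighbourhoods of every
point, and their probabilities are differences of values of the distribution functions. -/
theorem tendstoInDistribution_of_forall_tendsto_measureReal_le {ι : Type*} {l : Filter ι}
    [l.IsCountablyGenerated] {Ω : ι → Type*} [∀ i, MeasurableSpace (Ω i)]
    {μ : ∀ i, Measure (Ω i)} [∀ i, IsProbabilityMeasure (μ i)] {X : ∀ i, Ω i → ℝ}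
    {Ω' : Type*} [MeasurableSpace Ω'] {P : Measure Ω'} [IsProbabilityMeasure P] {Y : Ω' → ℝ}
    (hX : ∀ i, Measurable (X i)) (hY : Measurable Y)
    (h : ∀ y, Tendsto (fun i => (μ i).real {ω | X i ω ≤ y}) l (nhds (P.real {ω | Y ω ≤ y}))) :
    TendstoInDistribution X l Y μ P where
  forall_aemeasurable i := (hX i).aemeasurable
  aemeasurable_limit := hY.aemeasurable
  tendsto := by
    refine (isPiSystem_Ioc (id : ℝ → ℝ) id).tendsto_probabilityMeasure_of_tendsto_of_mem ?_ ?_ ?_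
    · rintro _ ⟨a, b, -, rfl⟩
      exact measurableSet_Ioc
    · intro u hu x hx
      obtain ⟨ε, hε, hball⟩ := Metric.isOpen_iff.1 hu x hx
      refine ⟨Set.Ioc (x - ε / 2) (x + ε / 2), ⟨_, _, by simp; linarith, rfl⟩,
        Ioc_mem_nhds (by linarith) (by linarith), fun z hz => hball ?_⟩
      rw [Metric.mem_ball, Real.dist_eq, abs_lt]
      constructor <;> linarith [hz.1, hz.2]
    · rintro _ ⟨a, b, hab, rfl⟩
      rw [← NNReal.tendsto_coe]
      change Tendsto (fun i => ((μ i).map (X i)).real (Set.Ioc a b)) l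
        (nhds ((P.map Y).real (Set.Ioc a b)))
      have hab' : a ≤ b := hab.le
      rw [measureReal_map_Ioc hY hab']
      refine ((h b).sub (h a)).congr fun i => (measureReal_map_Ioc (hX i) hab').symm

/-! ### The limit law -/

theorem theorem8
    (ν₁ ν₂ : ℕ) (hν₁ : 1 ≤ ν₁) (hν₂ : 1 ≤ ν₂)
    (lam : ℝ) (hlam : 1 < lam)
    (p₁ p₂ : ℕ+ → ℝ) (hp₁ : ∀ M, 0 < p₁ M) (hp₂ : ∀ M, 0 < p₂ M)
    (hratio : ∀ M, p₂ M / p₁ M = lam)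
    {Ω : ℕ+ → Type*} [∀ M, MeasurableSpace (Ω M)]
    (μ : ∀ M, Measure (Ω M)) [∀ M, IsProbabilityMeasure (μ M)]
    (C : ∀ M : ℕ+, ℕ → Ω M → Coupon (ν₁ * M) (ν₂ * M))
    (hC : ∀ M, IsCouponSampling (μ M) (p₁ M) (p₂ M) (C M))
    {Ω' : Type*} [MeasurableSpace Ω'] (P : Measure Ω') [IsProbabilityMeasure P]
    (Y : Ω' → ℝ) (hY : IsStandardGumbel Y P) :
    (∀ M, ∀ᵐ ω ∂(μ M), timeAll (fun n => C M n ω) ≠ ⊤) ∧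
    TendstoInDistribution
      (fun (M : ℕ+) (ω : Ω M) =>
        (((timeAll (fun n => C M n ω)).toNat : ℝ)
            - ((ν₁ : ℝ) + lam * (ν₂ : ℝ)) * (M : ℝ) * Real.log (M : ℝ))
          / (((ν₁ : ℝ) + lam * (ν₂ : ℝ)) * (M : ℝ)) - Real.log (ν₁ : ℝ))
      atTop Y μ P := by
  have hfin : ∀ M, ∀ᵐ ω ∂(μ M), timeAll (fun n => C M n ω) ≠ ⊤ := fun M =>
    (hC M).ae_timeAll_ne_top (hp₁ M) (hp₂ M)
  refine ⟨hfin, ?_⟩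
  have hq : ∀ M, p₂ M = lam * p₁ M := fun M => by
    rw [← hratio M, div_mul_cancel₀ _ (hp₁ M).ne']
  have htot : ∀ M : ℕ+, ((ν₁ : ℝ) + lam * ν₂) * M * p₁ M = 1 := fun M => by
    have h := (hC M).total_eq_one
    rw [hq] at h
    push_cast at h
    linarith
  have hν₁' : (0 : ℝ) < ν₁ := by exact_mod_cast hν₁
  have hMpos : ∀ M : ℕ+, (0 : ℝ) < M := fun M => by exact_mod_cast M.pos
  have hmp : ∀ M : ℕ+, ((ν₁ * M : ℕ) : ℝ) * p₁ M ≤ 1 := fun M => by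
    have h := (hC M).total_eq_one
    have := mul_nonneg (Nat.cast_nonneg (α := ℝ) (ν₂ * M)) (hp₂ M).le
    linarith
  have hq1 : ∀ M, p₂ M ≤ 1 := fun M => by
    have hj : 0 < ν₂ * (M : ℕ) := Nat.mul_pos hν₂ M.pos
    rw [← (hC M).prob_group_two 0 ⟨0, hj⟩]
    exact measureReal_le_one
  have hm : Tendsto (fun M : ℕ+ => ν₁ * (M : ℕ)) atTop atTop := by
    refine tendsto_atTop_mono (fun M => Nat.le_mul_of_pos_left _ hν₁) ?_
    exact tendsto_PNat_val_atTop_atTop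
  refine tendstoInDistribution_of_forall_tendsto_measureReal_le (fun M => ?_) hY.measurable
    fun y => ?_
  · have h1 : Measurable fun t : ℕ∞ => (t.toNat : ℝ) := measurable_from_top
    exact (((h1.comp (hC M).measurable_timeAll).sub_const _).div_const _).sub_const _
  rw [hY.cdf_eq]
  -- The total probability is one, so `(ν₁ + lam * ν₂) * M = 1 / p₁`, and the normalized time is at
  -- most `y` exactly when `T ≤ (log M₁ + y) / p₁`.
  set n : ℕ+ → ℕ := fun M => ⌊(Real.log ((ν₁ * M : ℕ) : ℝ) + y) / p₁ M⌋₊ with hn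
  have hnp : Tendsto (fun M : ℕ+ => n M * p₁ M - Real.log ((ν₁ * M : ℕ) : ℝ)) atTop (nhds y) :=
    tendsto_natFloor_mul_sub_log hm hp₁ hmp y
  have hone : Tendsto (fun M => (μ M).real {ω | timeGroupOne (fun k => C M k ω) ≤ n M}) atTop
      (nhds (Real.exp (-Real.exp (-y)))) := by
    simp_rw [(hC _).measureReal_timeGroupOne_le]
    exact tendsto_sum_choose_mul_one_sub_pow hm (fun M => (hp₁ M).le) hmp hnp
  have htwo : Tendsto (fun M : ℕ+ => ((ν₂ * M : ℕ) : ℝ) * (1 - p₂ M) ^ n M) atTop (nhds 0) :=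
    tendsto_mul_one_sub_mul_pow_zero (a := ν₂ / ν₁) hlam hm
      (fun M => by push_cast; field_simp) hq hq1 hnp
  have hall : Tendsto (fun M => (μ M).real {ω | timeAll (fun k => C M k ω) ≤ n M}) atTop
      (nhds (Real.exp (-Real.exp (-y)))) := by
    have hdiff := squeeze_zero_norm (fun M => by
      rw [Real.norm_eq_abs]; exact (hC M).abs_measureReal_timeAll_le_sub_le (n M)) htwo
    simpa using hone.add hdiff
  have hlog : ∀ᶠ M : ℕ+ in atTop, -y ≤ Real.log ((ν₁ * M : ℕ) : ℝ) :=
    (Real.tendsto_log_atTop.comp (tendsto_natCast_atTop_atTop.comp hm)).eventually_ge_atTop _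
  refine hall.congr' ?_
  filter_upwards [hlog] with M hM
  refine measureReal_congr ?_
  filter_upwards [hfin M] with ω hω
  refine propext ?_
  -- Finiteness of `T` matters here: `toNat` would send the value `⊤` to `0`.
  obtain ⟨t, ht⟩ := ENat.ne_top_iff_exists.1 hω
  change timeAll (fun k => C M k ω) ≤ n M ↔ _ ≤ y
  have hK : ((ν₁ : ℝ) + lam * ν₂) * M = (p₁ M)⁻¹ := eq_inv_of_mul_eq_one_left (htot M)
  have hlogmul : Real.log ((ν₁ * M : ℕ) : ℝ) = Real.log ν₁ + Real.log M := by
    push_cast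
    exact Real.log_mul hν₁'.ne' (hMpos M).ne'
  rw [← ht, hK, ENat.toNat_natCast, Nat.cast_le, hn,
    Nat.le_floor_iff (div_nonneg (by linarith) (hp₁ M).le), le_div_iff₀ (hp₁ M), hlogmul]
  have : ((t : ℝ) - (p₁ M)⁻¹ * Real.log M) / (p₁ M)⁻¹ = t * p₁ M - Real.log M := by
    have := (hp₁ M).ne'
    field_simp
  rw [this]
  constructor <;> intro h <;> linarith
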